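/- A first-order theory $T$ has the independence property if there are a formula $\varphi(\bar x,\bar y)$, a model $M\models T$, and finite tuples $(\bar a_i)_{i\in\mathbb N}$ and $(\bar b_I)_{I\subseteq\mathbb N}$ in $M$ such that, for all $i\in\mathbb N$ and $I\subseteq\mathbb N$, $M\models\varphi(\bar a_i,\bar b_I)$ if and only if $i\in I$. A theory is NIP if it does not have the independence property, and a field $K$ is NIP if its complete theory in the language of rings is NIP. Let $K$ be an infinite NIP field of characteristic $p>0$, and let $L/K$ be a finite separable field extension. Then $p$ does not divide $[L:K]$. -/

import Mathlib

namespace FirstOrder.Language.Theory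

universe u v

/-- A theory `T` has the independence property if there are a formula `φ(x̄, ȳ)` in finitely many
variables, a model `M` of `T`, tuples `a i` (for `i : ℕ`) and tuples `b I` (for `I ⊆ ℕ`) in `M` such
that `M ⊨ φ(a i, b I)` if and only if `i ∈ I`. Models range over the universe of the language, which
has room for models of cardinality `|L| + 2 ^ ℵ₀`, so by the downward Löwenheim-Skolem theorem
the choice of universe makes no difference. -/
def HasIndependenceProperty {L : Language.{u, v}} (T : L.Theory) : Prop :=
  ∃ (m n : ℕ) (φ : L.Formula (Fin m ⊕ Fin n)) (M : ModelType.{u, v, max u v} T)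
    (a : ℕ → Fin m → M) (b : Set ℕ → Fin n → M),
    ∀ (i : ℕ) (I : Set ℕ), φ.Realize (Sum.elim (a i) (b I)) ↔ i ∈ I

/-- A theory is NIP (dependent) if it does not have the independence property. -/
def IsNIP {L : Language.{u, v}} (T : L.Theory) : Prop :=
  ¬ T.HasIndependenceProperty

end FirstOrder.Language.Theory

/-- A field is NIP if its complete first-order theory in the language of rings is NIP. -/
def IsNIPField (K : Type*) [Field K] : Prop :=
  letI := FirstOrder.Ring.compatibleRingOfRing K
  (FirstOrder.Language.ring.completeTheory K).IsNIP

/-! If `p` divided `[L:K]`, Cauchy's theorem in the Galois group of the normal closure `N` would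
give `σ` of order `p`. With `F` the fixed field of `σ`, `exists_map_eq_add_one` gives `x` in `N`
outside `F` with `x ^ p - x` in `F`. This is impossible if `z ↦ z ^ p - z` is onto on `F`.
Surjectivity is where NIP enters. If `e` is not a value, `exists_artinSchreier_twist` builds, for
each `n`, multipliers sending all but one of `n` given elements into the image; their sums shatter
`n` points. Coordinates over `K` and compactness turn this into the independence property for `K`.
-/

section ArtinSchreier

/-! ### Shattering by the image of the Artin-Schreier map. -/

variable {F : Type*} [Field F] (p : ℕ) [Fact p.Prime] [CharP F p]

/-- The additive map `z ↦ z ^ p - z` on a field of characteristic `p`. -/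
def artinSchreier : F →+ F :=
  (frobenius F p).toAddMonoidHom - AddMonoidHom.id F

variable {p}

@[simp]
lemma artinSchreier_apply (z : F) : artinSchreier p z = z ^ p - z := rfl

/-- For a finite set `s` of elements of a family linearly independent over the prime field, there
are functions `t` and `c` such that `b ^ p ^ (N + #s) * t x ≡ c b ^ p ^ N * x` modulo the image of
the Artin-Schreier map, where `c` is linear over the prime field with kernel spanned by `s`. -/
lemma exists_artinSchreier_twist [Algebra (ZMod p) F] {β : ℕ → F}
    (hβ : LinearIndependent (ZMod p) β) (s : Finset ℕ) (N : ℕ) :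
    ∃ (t : F → F) (c : F →ₗ[ZMod p] F),
      (∀ b, c b = 0 ↔ b ∈ Submodule.span (ZMod p) (β '' s)) ∧
      ∀ b x, b ^ p ^ (N + s.card) * t x - c b ^ p ^ N * x ∈ (artinSchreier (F := F) p).range := by
  induction s using Finset.induction_on generalizing N with
  | empty => exact ⟨id, LinearMap.id, by simp, fun b x => ⟨0, by
    simp [(Fact.out (p := p.Prime)).ne_zero]⟩⟩
  | insert j s hj ih =>
    obtain ⟨t, c, hc, ht⟩ := ih (N + 1)
    have hc0 : c (β j) ≠ 0 := by
      rw [Ne, hc]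
      exact hβ.notMem_span_image (by simpa using hj)
    -- With `d = c b / c (β j)`, this substitution turns `c b ^ p ^ (N + 1) * x` into `d ^ p ^ (N +
    -- 1) * (y ^ p - y)`. Modulo the image, `(d ^ p ^ N * y) ^ p ≡ d ^ p ^ N * y`, leaving `(d - d ^
    -- p) ^ p ^ N * y`. One Frobenius power is lost, hence `ih (N + 1)`. The new coefficient
    -- vanishes iff `d` is in the prime field, which adds `β j` to the kernel.
    refine ⟨fun y => t ((y ^ p - y) / c (β j) ^ p ^ (N + 1)),
      -((artinSchreier (F := F) p).comp ((AddMonoidHom.mulRight (c (β j))⁻¹).comp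
        c.toAddMonoidHom)).toZModLinearMap p, fun b => ?_, fun b y => ?_⟩
    · have key : (∃ m : ZMod p, c b / c (β j) = algebraMap (ZMod p) F m) ↔
          b ∈ Submodule.span (ZMod p) (β '' (insert j s : Finset ℕ)) := by
        rw [Finset.coe_insert, Set.image_insert_eq, Submodule.mem_span_insert']
        constructor
        · rintro ⟨m, hm⟩
          refine ⟨-m, (hc _).1 ?_⟩
          rw [div_eq_iff hc0, ← Algebra.smul_def] at hm
          simp [hm]
        · rintro ⟨m, hm⟩
          refine ⟨-m, ?_⟩
          have := (hc _).2 hm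
          rw [map_add, map_smul, ← eq_neg_iff_add_eq_zero] at this
          rw [div_eq_iff hc0, ← Algebra.smul_def, this]
          simp
      rw [← key]
      have h2 : ∀ d : F, d ^ p - d = 0 ↔ ∃ m : ZMod p, d = algebraMap (ZMod p) F m := by
        intro d
        rw [sub_eq_zero]
        constructor
        · intro h
          have h3 := (Subfield.mem_bot_iff_pow_eq_self F p).2 h
          rw [← ZMod.fieldRange_castHom_eq_bot p] at h3
          obtain ⟨m, hm⟩ := h3
          exact ⟨m, hm.symm.trans (RingHom.congr_fun (Subsingleton.elim _ _) m)⟩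
        · rintro ⟨m, rfl⟩
          rw [← map_pow, ZMod.pow_card]
      rw [← h2, div_eq_mul_inv]
      change -((c b * (c (β j))⁻¹) ^ p - c b * (c (β j))⁻¹) = 0 ↔ _
      rw [neg_eq_zero]
    · have h1 := ht b ((y ^ p - y) / c (β j) ^ p ^ (N + 1))
      rw [Finset.card_insert_of_notMem hj]
      obtain ⟨d, hd⟩ : ∃ d, d = c b * (c (β j))⁻¹ := ⟨_, rfl⟩
      have h2 := add_mem h1 (AddMonoidHom.mem_range.2 ⟨d ^ p ^ N * y, rfl⟩)
      convert h2 using 1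
      change _ - (-((c b * (c (β j))⁻¹) ^ p - c b * (c (β j))⁻¹)) ^ p ^ N * y = _ + ((d ^ p ^ N * y) ^ p - d ^ p ^ N * y)
      rw [← hd]
      have h3 : c b ^ p ^ (N + 1) * ((y ^ p - y) / c (β j) ^ p ^ (N + 1)) =
          d ^ p ^ (N + 1) * (y ^ p - y) := by
        rw [hd, mul_pow, inv_pow]; ring
      have h4 : (-(d ^ p - d)) ^ p ^ N = d ^ p ^ N - d ^ p ^ (N + 1) := by
        rw [neg_sub, sub_pow_char_pow, ← pow_mul, ← pow_succ']
      rw [h3, h4, mul_pow (d ^ p ^ N), ← pow_mul, ← pow_succ, show N + 1 + s.card = N + (s.card + 1) by ring]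
      ring

omit [CharP F p] in
lemma exists_linearIndependent_nat [Algebra (ZMod p) F] [Infinite F] :
    ∃ β : ℕ → F, LinearIndependent (ZMod p) β := by
  let B := Module.Basis.ofVectorSpace (ZMod p) F
  have : Infinite (Module.Basis.ofVectorSpaceIndex (ZMod p) F) := by
    by_contra h
    rw [not_infinite_iff_finite] at h
    have := Module.Finite.of_basis B
    have : Finite F := Module.finite_of_finite (ZMod p)
    exact not_finite F
  exact ⟨_, B.linearIndependent.comp _ (Infinite.natEmbedding _).injective⟩

/-- If the Artin-Schreier map of an infinite field is not surjective, then the relation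
`∃ z, a * t = z ^ p - z` shatters arbitrarily large finite sets. -/
lemma exists_artinSchreier_shatter [Infinite F] {e : F}
    (he : e ∉ (artinSchreier (F := F) p).range) (n : ℕ) :
    ∃ (a : ℕ → F) (t : Set ℕ → F), ∀ i < n, ∀ I : Set ℕ,
      a i * t I ∈ (artinSchreier (F := F) p).range ↔ i ∈ I := by
  classical
  let _ := ZMod.algebra F p
  obtain ⟨β, hβ⟩ := exists_linearIndependent_nat (F := F) (p := p)
  have key : ∀ j < n, ∃ u : F, β j ^ p ^ (n - 1) * u ∉ (artinSchreier (F := F) p).range ∧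
      ∀ i < n, i ≠ j → β i ^ p ^ (n - 1) * u ∈ (artinSchreier (F := F) p).range := by
    intro j hj
    obtain ⟨t, c, hc, ht⟩ := exists_artinSchreier_twist hβ ((Finset.range n).erase j) 0
    rw [Finset.card_erase_of_mem (by simpa using hj), Finset.card_range] at ht
    simp only [zero_add, pow_zero, pow_one] at ht
    have hc0 : c (β j) ≠ 0 := by
      rw [Ne, hc]
      exact hβ.notMem_span_image (by simp)
    refine ⟨t (e / c (β j)), fun h => he ?_, fun i hi hij => ?_⟩
    · have := sub_mem h (ht (β j) (e / c (β j)))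
      rwa [sub_sub_cancel, mul_div_cancel₀ _ hc0] at this
    · have := ht (β i) (e / c (β j))
      rwa [(hc (β i)).2 (Submodule.subset_span ⟨i, by simp [hi, hij], rfl⟩), zero_mul,
        sub_zero] at this
  choose! u hu hu' using key
  -- In `a i * t I` only the term `j = i` can leave the image, and it is present exactly when `i ∉
  -- I`.
  refine ⟨fun i => β i ^ p ^ (n - 1), fun I => ∑ j ∈ (Finset.range n).filter (· ∉ I), u j,
    fun i hi I => ?_⟩
  rw [Finset.mul_sum]
  constructor
  · intro h
    by_contra hiI
    rw [← Finset.add_sum_erase _ _ (a := i) (by simp [hi, hiI])] at h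
    refine hu i hi ((AddSubgroup.add_mem_cancel_right _ (sum_mem fun j hj => ?_)).1 h)
    simp only [Finset.mem_erase, Finset.mem_filter, Finset.mem_range] at hj
    exact hu' j hj.2.1 i hi (Ne.symm hj.1)
  · intro hiI
    refine sum_mem fun j hj => ?_
    simp only [Finset.mem_filter, Finset.mem_range] at hj
    exact hu' j hj.1 i hi fun h => hj.2 (h ▸ hiI)

end ArtinSchreier

/-! ### Compactness. -/

namespace FirstOrder.Language

universe u v w

open Theory

/-- If a formula shatters arbitrarily large finite sets in `M`, then the complete theory of `M` has
the independence property. -/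
theorem hasIndependenceProperty_of_forall_finite {L : Language.{u, v}} {M : Type w} [L.Structure M]
    [Nonempty M] {A B : Type*} [Finite A] [Finite B] (φ : L.Formula (A ⊕ B))
    (h : ∀ n : ℕ, ∃ (a : ℕ → A → M) (b : Set ℕ → B → M), ∀ i < n, ∀ I : Set ℕ,
      φ.Realize (Sum.elim (a i) (b I)) ↔ i ∈ I) :
    (L.completeTheory M).HasIndependenceProperty := by
  classical
  obtain ⟨m, ⟨eA⟩⟩ := Finite.exists_equiv_fin A
  obtain ⟨n, ⟨eB⟩⟩ := Finite.exists_equiv_fin B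
  let C := (ℕ × Fin m) ⊕ (Set ℕ × Fin n)
  let ψ : ℕ → Set ℕ → L.Formula C := fun i I =>
    φ.relabel (Sum.map (fun x => (i, eA x)) (fun y => (I, eB y)))
  let χ : ℕ → Set ℕ → L[[C]].Sentence := fun i I =>
    Formula.equivSentence (if i ∈ I then ψ i I else ∼(ψ i I))
  -- The constants name all `a i` and `b I`; stage `N` constrains only `i < N`, so `M` itself is a
  -- model of it.
  let T : ℕ → L[[C]].Theory := fun N =>
    (L.lhomWithConstants C).onTheory (L.completeTheory M) ∪
      {σ | ∃ i < N, ∃ I, σ = χ i I}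
  have hT : Theory.IsSatisfiable (⋃ N, T N) := by
    rw [isSatisfiable_directed_union_iff]
    · intro N
      obtain ⟨a, b, hab⟩ := h N
      let c : C → M := Sum.elim (fun x => a x.1 (eA.symm x.2)) (fun y => b y.1 (eB.symm y.2))
      let := constantsOn.structure c
      have hM : M ⊨ T N := by
        refine Theory.Model.union ((LHom.onTheory_model _ _).2 inferInstance) ⟨?_⟩
        rintro _ ⟨i, hi, I, rfl⟩
        have hr : (ψ i I).Realize c ↔ i ∈ I := by
          rw [← hab i hi I, Formula.realize_relabel]
          convert Iff.rfl using 2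
          ext (x | x) <;> simp [c]
        refine (Formula.realize_equivSentence M _).2 ?_
        change Formula.Realize _ c
        split_ifs with hiI
        · exact hr.2 hiI
        · rw [Formula.realize_not, hr]
          exact hiI
      exact Theory.Model.isSatisfiable M
    · refine Monotone.directed_le fun N N' hN => ?_
      refine Set.union_subset_union_right _ ?_
      rintro _ ⟨i, hi, I, rfl⟩
      exact ⟨i, hi.trans_le hN, I, rfl⟩
  obtain ⟨M'⟩ := hT
  have h1 : (M' : Type _) ⊨ (L.lhomWithConstants C).onTheory (L.completeTheory M) :=
    Theory.Model.mono M'.is_model (Set.subset_iUnion_of_subset 0 Set.subset_union_left)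
  let M₁ : ((L.lhomWithConstants C).onTheory (L.completeTheory M)).ModelType := ⟨M'⟩
  let M₂ := ModelType.reduct (L.lhomWithConstants C) M₁
  let : L.Structure M' := (L.lhomWithConstants C).reduct M'
  have : (L.lhomWithConstants C).IsExpansionOn M' := LHom.isExpansionOn_reduct _ _
  refine ⟨m, n, φ.relabel (Sum.map eA eB), M₂, fun i x => (L.con (Sum.inl (i, x) : C) : M'),
    fun I y => (L.con (Sum.inr (I, y) : C) : M'), fun i I => ?_⟩
  have h2 : (M' : Type _) ⊨ χ i I := Theory.realize_sentence_of_mem (⋃ N, T N)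
    (Set.mem_iUnion.2 ⟨i + 1, Or.inr ⟨i, i.lt_succ_self, I, rfl⟩⟩)
  have h3 := (Formula.realize_equivSentence M' _).1 h2
  have h4 : (φ.relabel (Sum.map eA eB)).Realize (M := M')
      (Sum.elim (fun x => (L.con (Sum.inl (i, x) : C) : M'))
        (fun y => (L.con (Sum.inr (I, y) : C) : M'))) ↔
      (ψ i I).Realize fun a => (L.con a : M') := by
    rw [Formula.realize_relabel, Formula.realize_relabel]
    convert Iff.rfl using 2
    ext (x | x) <;> rfl
  refine h4.trans ?_
  split_ifs at h3 with hiI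
  · exact iff_of_true h3 hiI
  · exact iff_of_false (Formula.realize_not.1 h3) hiI

end FirstOrder.Language


/-! ### Interpreting the finite extension in `K`. -/

open FirstOrder FirstOrder.Language in
/-- The Artin-Schreier map of a finite extension of an infinite NIP field is surjective. -/
theorem artinSchreier_surjective_of_isNIPField {K : Type*} [Field K] [Infinite K]
    (hK : IsNIPField K) {p : ℕ} [Fact p.Prime] {F : Type*} [Field F] [CharP F p] [Algebra K F]
    [FiniteDimensional K F] : Function.Surjective (artinSchreier (F := F) p) := by
  classical
  by_contra hsurj
  rw [Function.Surjective, not_forall] at hsurj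
  obtain ⟨e, he⟩ := hsurj
  let := FirstOrder.Ring.compatibleRingOfRing K
  have : Infinite F := Infinite.of_injective _ (algebraMap K F).injective
  let ι := Module.Free.ChooseBasisIndex K F
  let B : Module.Basis ι K F := Module.Free.chooseBasis K F
  let x : ι → FreeCommRing ((ι ⊕ (ι × ι) ⊕ (ι × ι)) ⊕ ι) := fun i => .of (.inl (.inl i))
  let y : ι → ι → FreeCommRing ((ι ⊕ (ι × ι) ⊕ (ι × ι)) ⊕ ι) :=
    fun i k => .of (.inl (.inr (.inl (i, k))))
  let r : ι → ι → FreeCommRing ((ι ⊕ (ι × ι) ⊕ (ι × ι)) ⊕ ι) :=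
    fun i k => .of (.inl (.inr (.inr (i, k))))
  let z : ι → FreeCommRing ((ι ⊕ (ι × ι) ⊕ (ι × ι)) ⊕ ι) := fun i => .of (.inr i)
  -- The parameters `y` and `r` are the coordinates of `B i * t` and `B i ^ p`; since `(∑ z i • B i)
  -- ^ p = ∑ z i ^ p • B i ^ p`, both sides are polynomial in coordinates.
  let φ : Language.ring.Formula (ι ⊕ (ι × ι) ⊕ (ι × ι)) :=
    Formula.iExs ι (BoundedFormula.iInf fun k : ι => Term.equal
      (Ring.termOfFreeCommRing (∑ i, x i * y i k))
      (Ring.termOfFreeCommRing (∑ i, z i ^ p * r i k - z k)))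
  have hφ : ∀ a t : F, φ.Realize (Sum.elim (fun i => B.repr a i)
      (Sum.elim (fun ik => B.repr (B ik.1 * t) ik.2) (fun ik => B.repr (B ik.1 ^ p) ik.2))) ↔
      a * t ∈ (artinSchreier (F := F) p).range := by
    intro a t
    have hr : ∀ w : ι → K, ∀ k, B.repr (artinSchreier p (B.equivFun.symm w)) k =
        ∑ i, w i ^ p * B.repr (B i ^ p) k - w k := by
      intro w k
      rw [artinSchreier_apply, map_sub, Finsupp.sub_apply]
      congr 1
      · rw [Module.Basis.equivFun_symm_apply, sum_pow_char, map_sum, Finsupp.finsetSum_apply]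
        simp [smul_pow]
      · exact congrFun (B.equivFun.apply_symm_apply w) k
    have hl : ∀ k, B.repr (a * t) k = ∑ i, B.repr a i * B.repr (B i * t) k := by
      intro k
      conv_lhs => rw [← B.sum_repr a, Finset.sum_mul, map_sum, Finsupp.finsetSum_apply]
      simp
    rw [Formula.realize_iExs, AddMonoidHom.mem_range]
    refine (B.equivFun.symm.toEquiv.exists_congr fun w => ?_)
    rw [Formula.Realize, BoundedFormula.realize_iInf]
    change (∀ k, Formula.Realize _ _) ↔ _
    simp only [Formula.realize_equal, Ring.realize_termOfFreeCommRing, map_sum, map_mul, map_sub,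
      map_pow, FreeCommRing.lift_of, x, y, z, r, Sum.elim_inl, Sum.elim_inr]
    rw [← B.repr.injective.eq_iff, Finsupp.ext_iff]
    refine forall_congr' fun k => ?_
    rw [← hl]
    exact eq_comm.trans (by rw [← hr]; rfl)
  refine hK (hasIndependenceProperty_of_forall_finite (A := ι) (B := (ι × ι) ⊕ (ι × ι)) φ
    fun n => ?_)
  obtain ⟨a, t, h⟩ := exists_artinSchreier_shatter (p := p) (e := e) he n
  exact ⟨fun i k => B.repr (a i) k, fun I => Sum.elim (fun ik => B.repr (B ik.1 * t I) ik.2)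
    (fun ik => B.repr (B ik.1 ^ p) ik.2), fun i hi I => (hφ _ _).trans (h i hi I)⟩

/-! ### Artin-Schreier generators and the degree. -/

/-- An automorphism `σ` of order `p` of a field of characteristic `p` satisfies `σ x = x + 1` for
some `x`. -/
lemma exists_map_eq_add_one {K N : Type*} [Field K] [Field N] [Algebra K N] {p : ℕ}
    [Fact p.Prime] [CharP K p] (σ : N ≃ₐ[K] N) (hσ : orderOf σ = p) : ∃ x, σ x = x + 1 := by
  let δ : Module.End K N := σ.toLinearMap - 1
  have hδ : ∀ x, δ x = σ x - x := fun x => rfl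
  have hpow : δ ^ p = 0 := by
    have : CharP (Module.End K N) p :=
      charP_of_injective_algebraMap (algebraMap K (Module.End K N)).injective p
    have hσp : (σ.toLinearMap : Module.End K N) ^ p = 1 := by
      rw [← hσ]
      ext x
      rw [Module.End.pow_apply]
      change σ^[orderOf σ] x = x
      rw [← AlgEquiv.coe_pow, pow_orderOf_eq_one, AlgEquiv.one_apply]
    rw [sub_pow_char_of_commute _ (Commute.one_right _), hσp, one_pow, sub_self]
  obtain ⟨v, hv⟩ : ∃ v, δ v ≠ 0 := by
    by_contra! h
    have : σ = 1 := by
      ext x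
      exact sub_eq_zero.1 ((hδ x).symm.trans (h x))
    rw [this, orderOf_one] at hσ
    exact (Fact.out (p := p.Prime)).one_lt.ne hσ
  have hex : ∃ m, (δ ^ m) v = 0 := ⟨p, by rw [hpow]; rfl⟩
  classical
  have hm := Nat.find_spec hex
  -- The last nonzero iterate `(δ ^ (k + 1)) v` is fixed by `σ`, and `σ` adds it to `(δ ^ k) v`;
  -- their quotient is the element sought.
  obtain ⟨k, hk⟩ : ∃ k, Nat.find hex = k + 2 := by
    have h0 : Nat.find hex ≠ 0 := by
      intro h; rw [h] at hm
      have hv0 : v = 0 := hm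
      exact hv (by rw [hv0, map_zero])
    have h1 : Nat.find hex ≠ 1 := by
      intro h; rw [h, pow_one] at hm; exact hv hm
    exact ⟨Nat.find hex - 2, by omega⟩
  have hk' : (δ ^ (k + 1)) v ≠ 0 := Nat.find_min hex (by omega)
  rw [hk, pow_succ', Module.End.mul_apply, hδ, sub_eq_zero] at hm
  refine ⟨(δ ^ k) v / (δ ^ (k + 1)) v, ?_⟩
  rw [map_div₀, hm, div_add_one hk']
  congr 1
  rw [pow_succ', Module.End.mul_apply, hδ]
  ring

theorem corollary4p4 {K : Type*} [Field K] [Infinite K] (hK : IsNIPField K)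
    {p : ℕ} (hp : 0 < p) [CharP K p]
    {L : Type*} [Field L] [Algebra K L] [FiniteDimensional K L] [Algebra.IsSeparable K L] :
    ¬ p ∣ Module.finrank K L := by
  intro hdvd
  have : NeZero p := ⟨hp.ne'⟩
  have : Fact p.Prime := ⟨CharP.char_is_prime_of_pos K p |>.out⟩
  let N := IntermediateField.normalClosure K L (AlgebraicClosure L)
  have : Algebra.IsSeparable K N := by
    have (f : L →ₐ[K] AlgebraicClosure L) : Algebra.IsSeparable K f.fieldRange :=
      .of_algHom _ _ (AlgEquiv.ofInjectiveField f).symm.toAlgHom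
    exact IntermediateField.isSeparable_iSup _ _
  have : IsGalois K N := { }
  have : CharP N p := charP_of_injective_algebraMap (algebraMap K N).injective p
  have hcard : p ∣ Nat.card (N ≃ₐ[K] N) := by
    rw [IsGalois.card_aut_eq_finrank, ← Module.finrank_mul_finrank K L N]
    exact hdvd.mul_right _
  obtain ⟨σ, hσ⟩ := exists_prime_orderOf_dvd_card' p hcard
  obtain ⟨x, hx⟩ := exists_map_eq_add_one σ hσ
  let F := IntermediateField.fixedField (Subgroup.zpowers σ)
  have hF : ∀ w, w ∈ F ↔ σ w = w := by
    intro w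
    rw [IntermediateField.mem_fixedField_iff]
    refine ⟨fun h => h σ (Subgroup.mem_zpowers σ), fun h τ hτ => ?_⟩
    have : Subgroup.zpowers σ ≤ MulAction.stabilizer (N ≃ₐ[K] N) w := by
      rw [Subgroup.zpowers_le]; exact h
    exact this hτ
  have : CharP F p := charP_of_injective_algebraMap (algebraMap K F).injective p
  have hmem : x ^ p - x ∈ F := by
    rw [hF, map_sub, map_pow, hx, add_pow_char, one_pow]
    ring
  obtain ⟨z, hz⟩ := artinSchreier_surjective_of_isNIPField hK (p := p) (F := F) ⟨_, hmem⟩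
  have hz' : (z : N) ^ p - z = x ^ p - x := congrArg Subtype.val hz
  -- Two solutions of the same Artin-Schreier equation differ by an element of the prime field,
  -- which lies in `F`.
  have hbot : x - z ∈ (⊥ : Subfield N) := by
    rw [Subfield.mem_bot_iff_pow_eq_self N p, sub_pow_char]
    linear_combination -hz'
  have hxF : x ∈ F := by
    have h : x - z ∈ F.toSubfield := (bot_le : (⊥ : Subfield N) ≤ _) hbot
    simpa using add_mem h z.2
  rw [hF, hx] at hxF
  exact one_ne_zero (add_eq_left.1 hxF)
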